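/- Let $\mu$ be a probability measure on the unit circle $\partial\mathbb{D}=\{z\in\mathbb{C}: |z|=1\}$ that is nontrivial, i.e. not supported on a finite set, and write $d\mu = w(\theta)\,\frac{d\theta}{2\pi}+d\mu_s$ with $\mu_s$ singular. Let $\Phi_n$ be its monic orthogonal polynomials (obtained from $1,z,z^2,\dots$ by Gram–Schmidt in $L^2(\mu)$), $\varphi_n=\Phi_n/\|\Phi_n\|_{L^2(\mu)}$ the orthonormal polynomials, and $\alpha_n=-\overline{\Phi_{n+1}(0)}$ $(n\ge 0)$ the Verblunsky coefficients. When the Szegő condition holds, i.e. $w>0$ a.e. and $\log w\in L^1(\frac{d\theta}{2\pi})$, the Szegő function is $$D(z)=\exp\Bigl(\frac{1}{4\pi}\int_0^{2\pi}\frac{e^{i\theta}+z}{e^{i\theta}-z}\,\log w(\theta)\,d\theta\Bigr),\qquad |z|<1 .$$ Let $0<b<1$. (1) If $b^{-n}\alpha_n\to C$ as $n\to\infty$ for some $C\in\mathbb{C}$, $C\neq 0$, then the Szegő condition holds (so that $D$ is defined), and for every $z$ with $|z|<b$, $$b^{-n}\varphi_n(z)\to \bar C\,(z-b)^{-1}D(z)^{-1}\qquad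 (n\to\infty).$$ (2) If $\alpha_n=Cb^n+O((b\Delta)^n)$ as $n\to\infty$ for some $C\in\mathbb{C}$ and $\Delta\in(0,1)$, then the Szegő condition holds, and for every $\varepsilon>0$ there are constants $C_1$ and $\tilde\Delta\in(0,1)$ such that for all $n\ge 0$ and all $z$ with $|z|<b-\varepsilon$, $$\bigl|b^{-n}\varphi_n(z)-\bar C\,(z-b)^{-1}D(z)^{-1}\bigr|\le C_1\,\tilde\Delta^{\,n}.$$ -/

import Mathlib

open MeasureTheory Filter Topology Asymptotics
open scoped ComplexConjugate

namespace OPUC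

/-- The unit circle carries its Borel sigma-algebra. -/
noncomputable instance instMeasurableSpaceCircle : MeasurableSpace Circle := borel Circle

instance instBorelSpaceCircle : BorelSpace Circle := ⟨rfl⟩

/-- The normalized arc length measure `dθ / 2π` on the unit circle. -/
noncomputable def arcMeasure : Measure Circle :=
  ENNReal.ofReal (2 * Real.pi)⁻¹ •
    (volume.restrict (Set.Ioc (0 : ℝ) (2 * Real.pi))).map Circle.exp

/-- A measure on the unit circle is nontrivial if it is not supported on a finite set. -/
def Nontrivial (μ : Measure Circle) : Prop :=
  ∀ s : Set Circle, s.Finite → μ sᶜ ≠ 0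

/-- The inner product `⟨P, Q⟩ = ∫ conj (P ζ) * Q ζ dμ(ζ)` of two polynomials in `L²(μ)`. -/
noncomputable def polyInner (μ : Measure Circle) (P Q : Polynomial ℂ) : ℂ :=
  ∫ ζ : Circle, conj (P.eval (ζ : ℂ)) * Q.eval (ζ : ℂ) ∂μ

/-- The norm of a polynomial in `L²(μ)`. -/
noncomputable def polyNorm (μ : Measure Circle) (P : Polynomial ℂ) : ℝ :=
  Real.sqrt (∫ ζ : Circle, ‖P.eval (ζ : ℂ)‖ ^ 2 ∂μ)

/-- The monic orthogonal polynomials `Φₙ` of `μ`: Gram-Schmidt orthogonalization, without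
normalization, of `1, z, z², …` in `L²(μ)`. -/
noncomputable def monicPoly (μ : Measure Circle) (n : ℕ) : Polynomial ℂ :=
  Polynomial.X ^ n - ∑ k : Fin n,
    Polynomial.C (polyInner μ (monicPoly μ k) (Polynomial.X ^ n) /
      polyInner μ (monicPoly μ k) (monicPoly μ k)) * monicPoly μ k
termination_by n

/-- The orthonormal polynomials `φₙ = Φₙ / ‖Φₙ‖` of `μ`, as functions on `ℂ`. -/
noncomputable def orthonormalPoly (μ : Measure Circle) (n : ℕ) (z : ℂ) : ℂ :=
  (monicPoly μ n).eval z / (polyNorm μ (monicPoly μ n) : ℂ)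

/-- The Verblunsky coefficients `αₙ = - conj (Φₙ₊₁ 0)` of `μ`. -/
noncomputable def verblunsky (μ : Measure Circle) (n : ℕ) : ℂ :=
  -conj ((monicPoly μ (n + 1)).eval 0)

/-- The density `w` in the Lebesgue decomposition `dμ = w dθ/2π + dμ_s`. -/
noncomputable def density (μ : Measure Circle) (ζ : Circle) : ℝ :=
  (μ.rnDeriv arcMeasure ζ).toReal

/-- The Szegő condition: `log w` is integrable with respect to `dθ/2π`. Since `Real.log 0 = 0`,
the part `w > 0` almost everywhere has to be said separately. -/
def SzegoCondition (μ : Measure Circle) : Prop :=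
  (∀ᵐ ζ ∂arcMeasure, 0 < density μ ζ) ∧
    Integrable (fun ζ => Real.log (density μ ζ)) arcMeasure

/-- The Szegő function `D(z) = exp ((1/4π) ∫ (e^{iθ} + z) / (e^{iθ} - z) * log w(e^{iθ}) dθ)`;
the constant is `1/2` because `arcMeasure` is `dθ/2π`. -/
noncomputable def szegoFunction (μ : Measure Circle) (z : ℂ) : ℂ :=
  Complex.exp ((1 / 2 : ℂ) *
    ∫ ζ : Circle, ((ζ : ℂ) + z) / ((ζ : ℂ) - z) * (Real.log (density μ ζ) : ℂ) ∂arcMeasure)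

/-- BLS asymptotics `αₙ = C bⁿ + O((b Δ)ⁿ)`. -/
def BLSAsymptotics (α : ℕ → ℂ) (b Δ : ℝ) (C : ℂ) : Prop :=
  (fun n : ℕ => α n - C * (b : ℂ) ^ n) =O[atTop] fun n : ℕ => (b * Δ) ^ n

end OPUC

namespace OPUC

open Polynomial

/-! Both statements rest on the Szegő recursion `Φₙ₊₁ = z Φₙ - conj αₙ Φₙ*`, `Φₙ₊₁* = Φₙ* - αₙ z
Φₙ`. In either case `αₙ = O(bⁿ)`, so `log φₙ*` is a sum of holomorphic terms of size `O(bⁿ)` on the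
closed disc, and `φₙ* → exp h` there at rate `bⁿ` (`exists_log_szego`).

The limit is identified without the general Szegő theorem. Orthogonality passes to the limit and
shows that all moments of `|exp h|² dμ` are those of arc length (`withDensity_eq_arcMeasure`). Hence
`μ` has density `exp (-2 Re h)` and no singular part; the Szegő condition is then immediate, and the
Schwarz formula gives `D = exp (-h)` (`szego_of_boundary`).

Finally, `b⁻ⁿ Φₙ(z)` minus its expected limit satisfies `eₙ₊₁ = (z/b) eₙ - dₙ`
(`rescaled_recursion`). For `|z| < b` this is a contraction, so `eₙ` inherits the decay of `dₙ`:
mere convergence in (1), a geometric rate in (2). Dividing by `‖Φₙ‖ → D(0)` gives `φₙ`. -/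

lemma integrable_of_continuous {E : Type*} [NormedAddCommGroup E] (μ : Measure Circle)
    [IsFiniteMeasure μ] {f : Circle → E} (hf : Continuous f) : Integrable f μ :=
  hf.integrable_of_hasCompactSupport (HasCompactSupport.of_compactSpace f)

@[fun_prop]
lemma continuous_eval_circle (P : ℂ[X]) : Continuous fun ζ : Circle => P.eval (ζ : ℂ) :=
  P.continuous.comp continuous_subtype_val

lemma degree_C_mul_le_degree (c : ℂ) (P : ℂ[X]) : (C c * P).degree ≤ P.degree := by
  rw [← smul_eq_C_mul]
  exact degree_smul_le c P

/-! ### Sesquilinear algebra of polynomials in `L²(μ)`. -/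

section Inner

variable (μ : Measure Circle)

lemma integrable_polyInner [IsFiniteMeasure μ] (P Q : ℂ[X]) :
    Integrable (fun ζ : Circle => conj (P.eval (ζ : ℂ)) * Q.eval (ζ : ℂ)) μ :=
  integrable_of_continuous μ (by fun_prop)

lemma polyInner_add_right [IsFiniteMeasure μ] (P Q R : ℂ[X]) :
    polyInner μ P (Q + R) = polyInner μ P Q + polyInner μ P R := by
  simp only [polyInner, eval_add, mul_add]
  exact integral_add (integrable_polyInner μ P Q) (integrable_polyInner μ P R)

lemma polyInner_C_mul_right (c : ℂ) (P Q : ℂ[X]) :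
    polyInner μ P (C c * Q) = c * polyInner μ P Q := by
  simp only [polyInner, eval_mul, eval_C, ← integral_const_mul]
  congr 1; ext ζ; ring

lemma polyInner_sub_right [IsFiniteMeasure μ] (P Q R : ℂ[X]) :
    polyInner μ P (Q - R) = polyInner μ P Q - polyInner μ P R := by
  simp only [polyInner, eval_sub, mul_sub]
  exact integral_sub (integrable_polyInner μ P Q) (integrable_polyInner μ P R)

lemma polyInner_sum_right [IsFiniteMeasure μ] {ι : Type*} (s : Finset ι) (P : ℂ[X])
    (Q : ι → ℂ[X]) :
    polyInner μ P (∑ i ∈ s, Q i) = ∑ i ∈ s, polyInner μ P (Q i) := by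
  simp only [polyInner, eval_finsetSum, Finset.mul_sum]
  exact integral_finsetSum s fun i _ => integrable_polyInner μ P (Q i)

lemma conj_polyInner (P Q : ℂ[X]) : conj (polyInner μ P Q) = polyInner μ Q P := by
  simp only [polyInner, ← integral_conj, map_mul, Complex.conj_conj]
  congr 1; ext ζ; ring

lemma polyInner_add_left [IsFiniteMeasure μ] (P Q R : ℂ[X]) :
    polyInner μ (P + Q) R = polyInner μ P R + polyInner μ Q R := by
  simp only [← conj_polyInner μ R, polyInner_add_right, map_add]

lemma polyInner_sub_left [IsFiniteMeasure μ] (P Q R : ℂ[X]) :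
    polyInner μ (P - Q) R = polyInner μ P R - polyInner μ Q R := by
  simp only [← conj_polyInner μ R, polyInner_sub_right, map_sub]

lemma polyInner_C_mul_left [IsFiniteMeasure μ] (c : ℂ) (P Q : ℂ[X]) :
    polyInner μ (C c * P) Q = conj c * polyInner μ P Q := by
  simp only [← conj_polyInner μ Q, polyInner_C_mul_right, map_mul]

lemma polyInner_X_mul (P Q : ℂ[X]) : polyInner μ (X * P) (X * Q) = polyInner μ P Q := by
  simp only [polyInner, eval_mul, eval_X, map_mul]
  congr 1; ext ζ
  have : conj (ζ : ℂ) * ζ = 1 := by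
    rw [← Complex.normSq_eq_conj_mul_self, Circle.normSq_coe, Complex.ofReal_one]
  linear_combination (conj (eval (ζ : ℂ) P) * eval (ζ : ℂ) Q) * this

lemma integral_norm_sq_nonneg (P : ℂ[X]) : 0 ≤ ∫ ζ : Circle, ‖P.eval (ζ : ℂ)‖ ^ 2 ∂μ :=
  integral_nonneg fun _ => by positivity

lemma polyNorm_sq (P : ℂ[X]) : polyNorm μ P ^ 2 = ∫ ζ : Circle, ‖P.eval (ζ : ℂ)‖ ^ 2 ∂μ :=
  Real.sq_sqrt (integral_norm_sq_nonneg μ P)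

lemma polyInner_self (P : ℂ[X]) : polyInner μ P P = ((polyNorm μ P ^ 2 : ℝ) : ℂ) := by
  rw [polyNorm_sq, ← integral_complex_ofReal, polyInner]
  congr 1; ext ζ
  rw [← Complex.normSq_eq_conj_mul_self, Complex.normSq_eq_norm_sq]

variable {μ}

lemma polyNorm_pos [IsFiniteMeasure μ] (hμ : Nontrivial μ) {P : ℂ[X]} (hP : P ≠ 0) :
    0 < polyNorm μ P := by
  refine Real.sqrt_pos.2 ((integral_norm_sq_nonneg μ P).lt_of_ne' fun h => ?_)
  rw [integral_eq_zero_iff_of_nonneg (fun _ => by positivity)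
    (integrable_of_continuous μ (by fun_prop))] at h
  have hfin : {ζ : Circle | P.eval (ζ : ℂ) = 0}.Finite :=
    Set.Finite.of_finite_image (f := ((↑) : Circle → ℂ))
      ((P.rootSet_finite ℂ).subset (by
        rintro _ ⟨ζ, hζ, rfl⟩
        exact (mem_rootSet.2 ⟨hP, by simpa using hζ⟩))) Subtype.val_injective.injOn
  refine hμ _ hfin ?_
  rw [Filter.EventuallyEq, ae_iff] at h
  convert h using 2
  ext ζ
  simp

lemma polyInner_self_ne_zero [IsFiniteMeasure μ] (hμ : Nontrivial μ) {P : ℂ[X]} (hP : P ≠ 0) :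
    polyInner μ P P ≠ 0 := by
  rw [polyInner_self]
  exact_mod_cast (pow_pos (polyNorm_pos hμ hP) 2).ne'

end Inner

/-! ### Orthogonality of the monic polynomials. -/

section Monic

variable (μ : Measure Circle)

lemma monicPoly_eq (n : ℕ) : monicPoly μ n = X ^ n - ∑ k : Fin n,
    C (polyInner μ (monicPoly μ k) (X ^ n) / polyInner μ (monicPoly μ k) (monicPoly μ k)) *
      monicPoly μ k := by
  rw [monicPoly]

lemma degree_monicPoly (n : ℕ) : (monicPoly μ n).degree = n ∧ (monicPoly μ n).Monic := by
  induction n using Nat.strong_induction_on with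
  | _ n ih =>
    have h : (∑ k : Fin n, C (polyInner μ (monicPoly μ k) (X ^ n) /
        polyInner μ (monicPoly μ k) (monicPoly μ k)) * monicPoly μ k).degree < n := by
      refine (degree_sum_le _ _).trans_lt ?_
      rw [Finset.sup_lt_iff (by exact_mod_cast WithBot.bot_lt_coe n)]
      intro k _
      refine (degree_C_mul_le_degree _ _).trans_lt ?_
      rw [(ih k k.2).1]
      exact_mod_cast k.2
    rw [monicPoly_eq]
    refine ⟨?_, monic_X_pow_sub h⟩
    rw [degree_sub_eq_left_of_degree_lt (by rwa [degree_X_pow]), degree_X_pow]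

lemma monicPoly_monic (n : ℕ) : (monicPoly μ n).Monic := (degree_monicPoly μ n).2

lemma monicPoly_zero : monicPoly μ 0 = 1 := by
  rw [monicPoly_eq]; simp

variable [IsFiniteMeasure μ] {μ}

lemma polyInner_monicPoly_of_lt (hμ : Nontrivial μ) {n k : ℕ} (hk : k < n) :
    polyInner μ (monicPoly μ k) (monicPoly μ n) = 0 := by
  induction n using Nat.strong_induction_on generalizing k with
  | _ n ih =>
    rw [monicPoly_eq μ n, polyInner_sub_right, polyInner_sum_right,
      Finset.sum_eq_single (⟨k, hk⟩ : Fin n)]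
    · rw [polyInner_C_mul_right, div_mul_cancel₀ _
        (polyInner_self_ne_zero hμ (monicPoly_monic μ k).ne_zero), sub_self]
    · intro j _ hj
      have hjk : (j : ℕ) ≠ k := fun h => hj (Fin.ext h)
      rw [polyInner_C_mul_right]
      rcases lt_or_gt_of_ne hjk with h | h
      · rw [← conj_polyInner μ (monicPoly μ j) (monicPoly μ k), ih k hk h, map_zero, mul_zero]
      · rw [ih j j.2 h, mul_zero]
    · simp

lemma polyInner_eq_zero_of_degree_lt {n : ℕ} {F : ℂ[X]}
    (hF : ∀ k < n, polyInner μ (monicPoly μ k) F = 0) {P : ℂ[X]} (hP : P.degree < n) :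
    polyInner μ P F = 0 := by
  induction n generalizing P with
  | zero =>
    have : P = 0 := by simpa [Nat.WithBot.lt_zero_iff] using hP
    simp [this, polyInner]
  | succ n ih =>
    have hdeg : (P - C (P.coeff n) * monicPoly μ n).degree < n := by
      rw [degree_lt_iff_coeff_zero]
      intro m hm
      rcases hm.eq_or_lt with rfl | hm
      · have : (monicPoly μ n).coeff n = 1 := by
          have := (monicPoly_monic μ n).coeff_natDegree
          rwa [natDegree_eq_of_degree_eq_some (degree_monicPoly μ n).1] at this
        simp [this]
      · rw [coeff_sub, coeff_C_mul, coeff_eq_zero_of_degree_lt (hP.trans_le (by exact_mod_cast hm)),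
          coeff_eq_zero_of_degree_lt (p := monicPoly μ n)
            (by rw [(degree_monicPoly μ n).1]; exact_mod_cast hm), mul_zero, sub_zero]
    have h := ih (fun k hk => hF k (hk.trans n.lt_succ_self)) hdeg
    rwa [polyInner_sub_left, polyInner_C_mul_left, hF n n.lt_succ_self, mul_zero, sub_zero] at h

lemma polyInner_monicPoly_of_degree_lt (hμ : Nontrivial μ) {n : ℕ} {P : ℂ[X]}
    (hP : P.degree < n) : polyInner μ P (monicPoly μ n) = 0 :=
  polyInner_eq_zero_of_degree_lt (fun _ hk => polyInner_monicPoly_of_lt hμ hk) hP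

end Monic

/-! ### The Szegő recursion and the norms. -/

section Recursion

variable (μ : Measure Circle)

/-- The reversed polynomials `Φₙ*(z) = zⁿ conj (Φₙ (1 / conj z))`, generated by the Szegő
recursion. -/
noncomputable def reversedPoly : ℕ → ℂ[X]
  | 0 => 1
  | n + 1 => reversedPoly n - C (verblunsky μ n) * (X * monicPoly μ n)

lemma degree_reversedPoly (n : ℕ) : (reversedPoly μ n).degree ≤ n := by
  induction n with
  | zero => simp [reversedPoly]
  | succ n ih =>
    refine (degree_sub_le _ _).trans (max_le (ih.trans (by exact_mod_cast n.le_succ)) ?_)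
    refine (degree_C_mul_le_degree _ _).trans ?_
    rw [mul_comm, degree_mul_X, (degree_monicPoly μ n).1]
    norm_cast

lemma eval_zero_reversedPoly (n : ℕ) : (reversedPoly μ n).eval 0 = 1 := by
  induction n with
  | zero => simp [reversedPoly]
  | succ n ih => simp [reversedPoly, ih]

variable {μ} [IsFiniteMeasure μ]

lemma coe_circle_mul_conj (ζ : Circle) : (ζ : ℂ) * conj (ζ : ℂ) = 1 := by
  rw [Complex.mul_conj, Circle.normSq_coe, Complex.ofReal_one]

/-- On the circle reversal turns `zᵏ` into `zⁿ⁻ᵏ`, so this is the orthogonality of `Φₙ` to lower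
powers. The reversal identity is a hypothesis because it is proved by induction together with the
recursion. -/
lemma polyInner_X_pow_of_reversed (hμ : Nontrivial μ) {n : ℕ} {Q : ℂ[X]}
    (hQ : ∀ ζ : Circle, Q.eval (ζ : ℂ) = (ζ : ℂ) ^ n * conj ((monicPoly μ n).eval (ζ : ℂ)))
    {k : ℕ} (hk : 1 ≤ k) (hkn : k ≤ n) : polyInner μ (X ^ k) Q = 0 := by
  have h : polyInner μ (X ^ k) Q = conj (polyInner μ (X ^ (n - k)) (monicPoly μ n)) := by
    simp only [polyInner, ← integral_conj]
    congr 1; ext ζ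
    obtain ⟨m, rfl⟩ := Nat.exists_eq_add_of_le hkn
    have := congrArg (· ^ k) (coe_circle_mul_conj ζ)
    simp only [mul_pow, one_pow] at this
    simp only [hQ, eval_pow, eval_X, map_mul, map_pow, Complex.conj_conj, pow_add,
      Nat.add_sub_cancel_left]
    linear_combination ((ζ : ℂ) ^ m * conj (eval (ζ : ℂ) (monicPoly μ (k + m)))) * this
  rw [h, polyInner_monicPoly_of_degree_lt hμ, map_zero]
  rw [degree_X_pow]
  exact_mod_cast (by omega : n - k < n)

lemma eq_zero_of_polyInner_X_pow (hμ : Nontrivial μ) {n : ℕ} {Q : ℂ[X]} (hdeg : Q.degree ≤ n)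
    (h0 : Q.eval 0 = 0) (hQ : ∀ k, 1 ≤ k → k ≤ n → polyInner μ (X ^ k) Q = 0) : Q = 0 := by
  by_contra hne
  apply polyInner_self_ne_zero hμ hne
  nth_rw 1 [Q.as_sum_range_C_mul_X_pow]
  rw [← conj_polyInner, polyInner_sum_right, map_sum]
  refine Finset.sum_eq_zero fun k hk => ?_
  rw [conj_polyInner, polyInner_C_mul_left]
  rcases Nat.eq_zero_or_pos k with rfl | hk0
  · rw [coeff_zero_eq_eval_zero, h0, map_zero, zero_mul]
  · have : k ≤ n := (Nat.lt_succ_iff.1 (Finset.mem_range.1 hk)).trans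
      (natDegree_le_of_degree_le hdeg)
    rw [hQ k hk0 this, mul_zero]

/-- The difference of the two sides has degree at most `n` since the leading terms cancel, vanishes
at `0` by the definition of `αₙ`, and is orthogonal to `z, …, zⁿ`; such a polynomial is orthogonal
to itself. -/
lemma szego_recursion_of_reversed (hμ : Nontrivial μ) {n : ℕ}
    (hQ : ∀ ζ : Circle, (reversedPoly μ n).eval (ζ : ℂ) =
      (ζ : ℂ) ^ n * conj ((monicPoly μ n).eval (ζ : ℂ))) :
    monicPoly μ (n + 1) = X * monicPoly μ n - C (conj (verblunsky μ n)) * reversedPoly μ n := by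
  have key : monicPoly μ (n + 1) - (X * monicPoly μ n)
      + C (conj (verblunsky μ n)) * reversedPoly μ n = 0 := by
    apply eq_zero_of_polyInner_X_pow hμ (n := n)
    · refine (degree_add_le _ _).trans (max_le ?_ ((degree_C_mul_le_degree _ _).trans
        (degree_reversedPoly μ n)))
      have hX : (X * monicPoly μ n).degree = ((n + 1 : ℕ) : WithBot ℕ) := by
        rw [mul_comm, degree_mul_X, (degree_monicPoly μ n).1]; norm_cast
      have := degree_sub_lt_left ((degree_monicPoly μ (n + 1)).1.trans hX.symm)
        (monicPoly_monic μ (n + 1)).ne_zero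
        (by rw [(monicPoly_monic μ (n + 1)).leadingCoeff,
          (monic_X.mul (monicPoly_monic μ n)).leadingCoeff])
      rw [(degree_monicPoly μ (n + 1)).1] at this
      rw [degree_lt_iff_coeff_zero] at this
      exact (degree_le_iff_coeff_zero _ _).2 fun m hm => this m (by exact_mod_cast hm)
    · simp [eval_zero_reversedPoly, verblunsky]
    · intro k hk hkn
      rw [polyInner_add_right, polyInner_sub_right, polyInner_C_mul_right,
        polyInner_X_pow_of_reversed hμ hQ hk hkn, polyInner_monicPoly_of_degree_lt hμ]
      · obtain ⟨m, rfl⟩ := Nat.exists_eq_add_of_le' hk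
        rw [pow_succ', polyInner_X_mul, polyInner_monicPoly_of_degree_lt hμ]
        · simp
        · rw [degree_X_pow]; exact_mod_cast hkn
      · rw [degree_X_pow]; exact_mod_cast Nat.lt_succ_of_le hkn
  linear_combination key

lemma eval_reversedPoly (hμ : Nontrivial μ) (n : ℕ) (ζ : Circle) :
    (reversedPoly μ n).eval (ζ : ℂ) = (ζ : ℂ) ^ n * conj ((monicPoly μ n).eval (ζ : ℂ)) := by
  induction n generalizing ζ with
  | zero => simp [reversedPoly, monicPoly_zero]
  | succ n ih =>
    rw [szego_recursion_of_reversed hμ ih, reversedPoly]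
    have h1 := coe_circle_mul_conj ζ
    have h2 := congrArg (· ^ n) h1
    simp only [mul_pow, one_pow] at h2
    simp only [eval_sub, eval_mul, eval_C, eval_X, ih, map_sub, map_mul, map_pow,
      Complex.conj_conj]
    linear_combination (-(ζ : ℂ) ^ n * conj (eval (ζ : ℂ) (monicPoly μ n))) * h1
      + (verblunsky μ n * ζ * eval (ζ : ℂ) (monicPoly μ n)) * h2

/-- The Szegő recursion. -/
lemma szego_recursion (hμ : Nontrivial μ) (n : ℕ) :
    monicPoly μ (n + 1) = X * monicPoly μ n - C (conj (verblunsky μ n)) * reversedPoly μ n :=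
  szego_recursion_of_reversed hμ (eval_reversedPoly hμ n)

lemma norm_eval_reversedPoly (hμ : Nontrivial μ) (n : ℕ) (ζ : Circle) :
    ‖(reversedPoly μ n).eval (ζ : ℂ)‖ = ‖(monicPoly μ n).eval (ζ : ℂ)‖ := by
  simp [eval_reversedPoly hμ, Circle.norm_coe]

lemma polyNorm_reversedPoly (hμ : Nontrivial μ) (n : ℕ) :
    polyNorm μ (reversedPoly μ n) = polyNorm μ (monicPoly μ n) := by
  simp only [polyNorm, norm_eval_reversedPoly hμ]

/-- Pythagoras for `z Φₙ = Φₙ₊₁ + conj αₙ Φₙ*`: the summands are orthogonal, and multiplication by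
`z` is isometric on the circle. -/
lemma polyNorm_monicPoly_succ_sq (hμ : Nontrivial μ) (n : ℕ) :
    polyNorm μ (monicPoly μ (n + 1)) ^ 2 =
      (1 - ‖verblunsky μ n‖ ^ 2) * polyNorm μ (monicPoly μ n) ^ 2 := by
  have horth : polyInner μ (reversedPoly μ n) (monicPoly μ (n + 1)) = 0 :=
    polyInner_monicPoly_of_degree_lt hμ
      ((degree_reversedPoly μ n).trans_lt (by exact_mod_cast n.lt_succ_self))
  have hX : X * monicPoly μ n =
      monicPoly μ (n + 1) + C (conj (verblunsky μ n)) * reversedPoly μ n := by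
    rw [szego_recursion hμ]; ring
  have h := polyInner_X_mul μ (monicPoly μ n) (monicPoly μ n)
  rw [hX, polyInner_add_left, polyInner_add_right, polyInner_add_right, polyInner_C_mul_left,
    polyInner_C_mul_left, polyInner_C_mul_right, polyInner_C_mul_right, horth,
    ← conj_polyInner μ (reversedPoly μ n) (monicPoly μ (n + 1)), horth, polyInner_self,
    polyInner_self, polyInner_self, polyNorm_reversedPoly hμ] at h
  have h' : (verblunsky μ n) * conj (verblunsky μ n) = ((‖verblunsky μ n‖ ^ 2 : ℝ) : ℂ) := by
    rw [Complex.mul_conj, Complex.normSq_eq_norm_sq]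
  simp only [map_zero, Complex.conj_conj, mul_zero, add_zero, zero_add, ← mul_assoc, h'] at h
  have h2 : polyNorm μ (monicPoly μ (n + 1)) ^ 2 +
      ‖verblunsky μ n‖ ^ 2 * polyNorm μ (monicPoly μ n) ^ 2 = polyNorm μ (monicPoly μ n) ^ 2 := by
    exact_mod_cast h
  linarith

lemma norm_verblunsky_lt_one (hμ : Nontrivial μ) (n : ℕ) : ‖verblunsky μ n‖ < 1 := by
  have h := polyNorm_monicPoly_succ_sq hμ n
  have h1 := pow_pos (polyNorm_pos hμ (monicPoly_monic μ (n + 1)).ne_zero) 2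
  have h2 := pow_pos (polyNorm_pos hμ (monicPoly_monic μ n).ne_zero) 2
  rw [h] at h1
  have := pos_of_mul_pos_left h1 h2.le
  nlinarith [norm_nonneg (verblunsky μ n)]

end Recursion

/-! ### Moments determine a finite measure on the circle. -/

section Moments

open BoundedContinuousFunction

/-- The character `ζ ↦ ζᵏ` of the circle. -/
noncomputable def circleChar (k : ℤ) : Circle →ᵇ ℂ :=
  mkOfCompact ⟨fun ζ => ((ζ ^ k : Circle) : ℂ),
    continuous_subtype_val.comp (continuous_zpow k)⟩

lemma circleChar_apply (k : ℤ) (ζ : Circle) : circleChar k ζ = ((ζ ^ k : Circle) : ℂ) := rfl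

lemma circleChar_neg (k : ℤ) (ζ : Circle) : circleChar (-k) ζ = conj (circleChar k ζ) := by
  rw [circleChar_apply, circleChar_apply, zpow_neg, Circle.coe_inv_eq_conj]

lemma circleChar_add (k l : ℤ) : circleChar k * circleChar l = circleChar (k + l) := by
  ext ζ
  rw [mul_apply]
  simp only [circleChar_apply, zpow_add, Circle.coe_mul]

/-- The star subalgebra of trigonometric polynomials. -/
noncomputable def trigSubalgebra : StarSubalgebra ℂ (Circle →ᵇ ℂ) where
  toSubalgebra := Algebra.adjoin ℂ (Set.range circleChar)
  star_mem' := by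
    change Algebra.adjoin ℂ (Set.range circleChar) ≤ star (Algebra.adjoin ℂ (Set.range circleChar))
    refine Algebra.adjoin_le ?_
    rintro - ⟨k, rfl⟩
    exact Algebra.subset_adjoin ⟨-k, ext fun ζ => circleChar_neg k ζ⟩

/-- Products of characters are characters, so integrals over the generated algebra need only be
compared on characters. -/
lemma trigSubalgebra_toSubmodule :
    Subalgebra.toSubmodule trigSubalgebra.toSubalgebra =
      Submodule.span ℂ (Set.range circleChar) := by
  apply Algebra.adjoin_eq_span_of_subset
  refine Set.Subset.trans ?_ Submodule.subset_span
  intro x hx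
  refine Submonoid.closure_induction (fun _ => id) ⟨0, ?_⟩ ?_ hx
  · ext ζ; simp [circleChar_apply]
  · rintro - - - - ⟨k, rfl⟩ ⟨l, rfl⟩
    exact ⟨k + l, (circleChar_add k l).symm⟩

/-- Finite measures on the circle with the same moments agree. -/
theorem ext_of_moments {μ ν : Measure Circle} [IsFiniteMeasure μ] [IsFiniteMeasure ν]
    (h : ∀ k : ℕ, ∫ ζ : Circle, (ζ : ℂ) ^ k ∂μ = ∫ ζ : Circle, (ζ : ℂ) ^ k ∂ν) : μ = ν := by
  have hint (k : ℤ) : ∫ ζ, circleChar k ζ ∂μ = ∫ ζ, circleChar k ζ ∂ν := by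
    obtain ⟨n, rfl | rfl⟩ := k.eq_nat_or_neg
    · simpa [circleChar_apply] using h n
    · simp only [circleChar_neg, integral_conj]
      congr 1
      simpa [circleChar_apply] using h n
  refine ext_of_forall_mem_subalgebra_integral_eq_of_polish (𝕜 := ℂ) (A := trigSubalgebra) ?_ ?_
  · intro x y hxy
    refine ⟨_, ⟨toContinuousMapStarₐ ℂ (circleChar 1),
      ⟨circleChar 1, Algebra.subset_adjoin ⟨1, rfl⟩, rfl⟩, rfl⟩, fun h => hxy ?_⟩
    change circleChar 1 x = circleChar 1 y at h
    exact Circle.ext (by simpa [circleChar_apply] using h)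
  · intro g hg
    have hg' : g ∈ Submodule.span ℂ (Set.range circleChar) := by
      rw [← trigSubalgebra_toSubmodule]; exact hg
    clear hg
    induction hg' using Submodule.span_induction with
    | mem x hx => obtain ⟨k, rfl⟩ := hx; exact hint k
    | zero => simp
    | add x y _ _ hx hy =>
      simp only [BoundedContinuousFunction.coe_add, Pi.add_apply]
      rw [integral_add (x.integrable μ) (y.integrable μ),
        integral_add (x.integrable ν) (y.integrable ν), hx, hy]
    | smul a x _ hx =>
      simp only [BoundedContinuousFunction.coe_smul]
      rw [integral_smul, integral_smul, hx]

end Moments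

/-! ### Arc length and the Schwarz integral formula. -/

section ArcMeasure

instance : IsFiniteMeasure arcMeasure := by
  unfold arcMeasure
  have : IsFiniteMeasure ((volume.restrict (Set.Ioc (0 : ℝ) (2 * Real.pi))).map Circle.exp) :=
    inferInstance
  exact Measure.smul_finite _ ENNReal.ofReal_ne_top

lemma integral_arcMeasure {E : Type*} [NormedAddCommGroup E] [NormedSpace ℝ E]
    (F : ℂ → E) (hF : Continuous fun ζ : Circle => F ζ) :
    ∫ ζ : Circle, F ζ ∂arcMeasure = Real.circleAverage F 0 1 := by
  rw [arcMeasure, integral_smul_measure, integral_map Circle.exp.continuous.aemeasurable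
    hF.aestronglyMeasurable, Real.circleAverage_def,
    intervalIntegral.integral_of_le Real.two_pi_pos.le,
    ENNReal.toReal_ofReal (inv_nonneg.2 Real.two_pi_pos.le)]
  simp [circleMap]

lemma integral_pow_arcMeasure (k : ℕ) :
    ∫ ζ : Circle, (ζ : ℂ) ^ k ∂arcMeasure = if k = 0 then 1 else 0 := by
  rw [integral_arcMeasure (fun z => z ^ k) (by fun_prop), DiffContOnCl.circleAverage
    (Differentiable.diffContOnCl (by fun_prop))]
  simp [zero_pow_eq]

/-- The Schwarz integral formula: a holomorphic function that is real at the origin is the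
Herglotz integral of the boundary values of its real part. -/
theorem circleAverage_herglotz_re {h : ℂ → ℂ} (hh : DiffContOnCl ℂ h (Metric.ball 0 1))
    (h0 : (h 0).im = 0) {z : ℂ} (hz : ‖z‖ < 1) :
    Real.circleAverage (fun ζ => (ζ + z) / (ζ - z) * ((h ζ).re : ℂ)) 0 1 = h z := by
  have hh1 : DiffContOnCl ℂ h (Metric.ball 0 |1|) := by simpa using hh
  have hne : ∀ ζ ∈ Metric.sphere (0 : ℂ) 1, ζ - z ≠ 0 := by
    intro ζ hζ h
    rw [sub_eq_zero.1 h] at hζ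
    simp at hζ; linarith
  have hcont : ContinuousOn h (Metric.sphere 0 1) :=
    hh.2.mono (Metric.sphere_subset_closedBall.trans_eq (closure_ball 0 one_ne_zero).symm)
  have hconj (ζ : ℂ) (hζ : ζ ∈ Metric.sphere (0 : ℂ) 1) : ζ * conj ζ = 1 := by
    rw [Complex.mul_conj, Complex.normSq_eq_norm_sq]
    simp at hζ; simp [hζ]
  have hI : ContinuousOn (fun ζ => ζ / (ζ - z) * h ζ) (Metric.sphere 0 1) :=
    (continuousOn_id.div (by fun_prop) hne).mul hcont
  have hden : ∀ ζ ∈ Metric.closedBall (0 : ℂ) 1, 1 - conj z * ζ ≠ 0 := by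
    intro ζ hζ h
    have h1 : ‖conj z * ζ‖ < 1 := by
      rw [norm_mul, RCLike.norm_conj]
      simp at hζ
      nlinarith [norm_nonneg z, norm_nonneg ζ]
    rw [← sub_eq_zero.1 h] at h1
    simp at h1
  -- On the circle this factor is the conjugate of the Herglotz kernel, but it is holomorphic in the
  -- disc, so the mean value property handles the `conj h` half of `Re h`.
  have hR : DiffContOnCl ℂ (fun ζ => (1 + conj z * ζ) / (1 - conj z * ζ) * h ζ)
      (Metric.ball 0 1) := by
    refine DiffContOnCl.smul (𝕜' := ℂ) (DifferentiableOn.diffContOnCl ?_) hh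
    rw [closure_ball 0 one_ne_zero]
    exact DifferentiableOn.div (by fun_prop) (by fun_prop) hden
  have e1 : Real.circleAverage (fun ζ => ζ / (ζ - z) * h ζ) 0 1 = h z := by
    simpa using hh1.circleAverage_smul_div (w := z) (by simpa using hz)
  have e2 : Real.circleAverage h 0 1 = h 0 := hh1.circleAverage
  have e3 : Real.circleAverage (fun ζ => (1 + conj z * ζ) / (1 - conj z * ζ) * h ζ) 0 1 = h 0 := by
    rw [DiffContOnCl.circleAverage (by simpa using hR)]; simp
  have hR' : ContinuousOn (fun ζ => (1 + conj z * ζ) / (1 - conj z * ζ) * h ζ)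
      (Metric.sphere 0 1) :=
    hR.2.mono (Metric.sphere_subset_closedBall.trans_eq (closure_ball 0 one_ne_zero).symm)
  have e4 : Real.circleAverage
      (fun ζ => conj ((1 + conj z * ζ) / (1 - conj z * ζ) * h ζ)) 0 1 = h 0 := by
    have := (Complex.conjCLE : ℂ →L[ℝ] ℂ).circleAverage_comp_comm
      (hR'.circleIntegrable zero_le_one)
    rw [e3] at this
    simpa [Function.comp_def, Complex.conj_eq_iff_im.2 h0] using this
  calc
    -- Half the kernel is `ζ/(ζ - z) - 1/2`. The three averages are `h z`, `h 0 / 2` and `conj (h 0)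
    -- / 2`; the last two cancel because `h 0` is real.
    _ = Real.circleAverage (fun ζ => ζ / (ζ - z) * h ζ - (1 / 2 : ℂ) • h ζ + (1 / 2 : ℂ) •
        conj ((1 + conj z * ζ) / (1 - conj z * ζ) * h ζ)) 0 1 := by
      refine Real.circleAverage_congr_sphere fun ζ hζ => ?_
      rw [abs_one] at hζ
      have h1 := hconj ζ hζ
      have h2 := hne ζ hζ
      have h3 : 1 - z * conj ζ ≠ 0 := by
        intro h
        apply h2
        linear_combination ζ * h + z * h1
      have hre : ((h ζ).re : ℂ) = (h ζ + conj (h ζ)) / 2 := by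
        rw [Complex.add_conj]; push_cast; ring
      have hk : (1 + z * conj ζ) / (1 - z * conj ζ) = (ζ + z) / (ζ - z) := by
        rw [div_eq_div_iff h3 h2]
        linear_combination (2 * z) * h1
      simp only [map_mul, map_div₀, map_add, map_sub, map_one, Complex.conj_conj, smul_eq_mul, hk,
        hre]
      field_simp
      ring
    _ = h z := by
      have i1 := hI.circleIntegrable zero_le_one
      have i2 : CircleIntegrable (fun ζ => (1 / 2 : ℂ) • h ζ) 0 1 :=
        (hcont.const_smul (1 / 2 : ℂ)).circleIntegrable zero_le_one
      have i3 : CircleIntegrable (fun ζ => (1 / 2 : ℂ) •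
          conj ((1 + conj z * ζ) / (1 - conj z * ζ) * h ζ)) 0 1 :=
        ((Complex.continuous_conj.comp_continuousOn hR').const_smul
          (1 / 2 : ℂ)).circleIntegrable zero_le_one
      have i12 : CircleIntegrable (fun ζ => ζ / (ζ - z) * h ζ - (1 / 2 : ℂ) • h ζ) 0 1 := i1.sub i2
      rw [Real.circleAverage_fun_add i12 i3, Real.circleAverage_fun_sub i1 i2,
        Real.circleAverage_fun_smul, Real.circleAverage_fun_smul, e1, e2, e4]
      simp

end ArcMeasure

/-! ### Reading off the density and the Szegő function. -/

section SzegoFunction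

variable {μ : Measure Circle}

/-- The weight is positive and finite, so the relation inverts and exhibits `μ` as absolutely
continuous. -/
lemma density_ae_eq_of_boundary {h : ℂ → ℂ} (hcont : Continuous fun ζ : Circle => h ζ)
    (hμh : μ.withDensity (fun ζ => ENNReal.ofReal (Real.exp (2 * (h ζ).re))) = arcMeasure) :
    ∀ᵐ ζ ∂arcMeasure, density μ ζ = Real.exp (-(2 * (h ζ).re)) := by
  set f : Circle → ENNReal := fun ζ => ENNReal.ofReal (Real.exp (2 * (h ζ).re)) with hf
  have hcf : Continuous f := by
    refine ENNReal.continuous_ofReal.comp (Real.continuous_exp.comp ?_)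
    exact continuous_const.mul (Complex.continuous_re.comp hcont)
  have hinv : arcMeasure.withDensity (fun ζ => (f ζ)⁻¹) = μ := by
    rw [← hμh]
    exact withDensity_inv_same hcf.measurable
      (ae_of_all _ fun ζ => (ENNReal.ofReal_pos.2 (Real.exp_pos _)).ne')
      (ae_of_all _ fun ζ => ENNReal.ofReal_ne_top)
  have := Measure.rnDeriv_withDensity arcMeasure (f := fun ζ => (f ζ)⁻¹) hcf.measurable.inv
  rw [hinv] at this
  filter_upwards [this] with ζ hζ
  rw [density, hζ, ENNReal.toReal_inv, hf, ENNReal.toReal_ofReal (Real.exp_pos _).le, Real.exp_neg]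

lemma continuous_circle_of_diffContOnCl {h : ℂ → ℂ} (hh : DiffContOnCl ℂ h (Metric.ball 0 1)) :
    Continuous fun ζ : Circle => h ζ := by
  refine hh.2.comp_continuous continuous_subtype_val fun ζ => ?_
  rw [closure_ball 0 one_ne_zero]
  simp [Circle.norm_coe]

/-- If `|exp h|² dμ` is arc length with `h` in the disc algebra and real at the origin, then the
Szegő condition holds and the Szegő function of `μ` is `exp (-h)`. -/
theorem szego_of_boundary {h : ℂ → ℂ} (hh : DiffContOnCl ℂ h (Metric.ball 0 1))
    (h0 : (h 0).im = 0)
    (hμh : μ.withDensity (fun ζ => ENNReal.ofReal (Real.exp (2 * (h ζ).re))) = arcMeasure) :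
    SzegoCondition μ ∧ ∀ z : ℂ, ‖z‖ < 1 → szegoFunction μ z = Complex.exp (-h z) := by
  have hcont := continuous_circle_of_diffContOnCl hh
  have hdens := density_ae_eq_of_boundary hcont hμh
  have hlog : ∀ᵐ ζ ∂arcMeasure, Real.log (density μ ζ) = -(2 * (h ζ).re) := by
    filter_upwards [hdens] with ζ hζ
    rw [hζ, Real.log_exp]
  refine ⟨⟨?_, ?_⟩, fun z hz => ?_⟩
  · filter_upwards [hdens] with ζ hζ
    rw [hζ]
    exact Real.exp_pos _
  · refine (integrable_of_continuous arcMeasure ?_).congr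
      (Filter.EventuallyEq.symm hlog)
    exact (continuous_const.mul (Complex.continuous_re.comp hcont)).neg
  · have hne (ζ : Circle) : (ζ : ℂ) - z ≠ 0 := by
      intro hζ
      rw [← sub_eq_zero.1 hζ, Circle.norm_coe] at hz
      exact lt_irrefl _ hz
    have hre : Continuous fun ζ : Circle => ((h ζ).re : ℂ) :=
      Complex.continuous_ofReal.comp (Complex.continuous_re.comp hcont)
    rw [szegoFunction]
    congr 1
    calc
      _ = (1 / 2 : ℂ) * ∫ ζ : Circle, (-2 : ℂ) *
          (((ζ : ℂ) + z) / ((ζ : ℂ) - z) * ((h ζ).re : ℂ)) ∂arcMeasure := by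
        congr 1
        refine integral_congr_ae ?_
        filter_upwards [hlog] with ζ hζ
        rw [hζ]
        push_cast
        ring
      _ = -Real.circleAverage (fun ζ => (ζ + z) / (ζ - z) * ((h ζ).re : ℂ)) 0 1 := by
        rw [integral_const_mul,
          integral_arcMeasure (fun ζ => (ζ + z) / (ζ - z) * ((h ζ).re : ℂ))]
        · ring
        · exact (Continuous.div (by fun_prop) (by fun_prop) hne).mul hre
      _ = _ := by rw [circleAverage_herglotz_re hh h0 hz]

end SzegoFunction

/-! ### Passing orthogonality to the limit. -/

section Limit

variable {μ : Measure Circle} [IsFiniteMeasure μ]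

lemma polyInner_X_pow_mul_reversedPoly (hμ : Nontrivial μ) {n k : ℕ} (hk : 1 ≤ k) :
    polyInner μ (X ^ k * reversedPoly μ n) (reversedPoly μ (n + k)) = 0 := by
  rw [(reversedPoly μ n).as_sum_range_C_mul_X_pow, Finset.mul_sum, ← conj_polyInner,
    polyInner_sum_right, map_sum]
  refine Finset.sum_eq_zero fun j hj => ?_
  have hjn : j ≤ n := (Nat.lt_succ_iff.1 (Finset.mem_range.1 hj)).trans
    (natDegree_le_of_degree_le (degree_reversedPoly μ n))
  rw [conj_polyInner, mul_left_comm, ← pow_add, polyInner_C_mul_left,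
    polyInner_X_pow_of_reversed hμ (eval_reversedPoly hμ (n + k)) (by omega) (by omega), mul_zero]

/-- If the normalized reversed polynomials converge boundedly to `g` on the circle, then `|g|² dμ`
is arc length. -/
theorem withDensity_eq_arcMeasure (hμ : Nontrivial μ) {g : Circle → ℂ} (hg : Continuous g) {B : ℝ}
    (hB : ∀ n (ζ : Circle),
      ‖(reversedPoly μ n).eval (ζ : ℂ) / (polyNorm μ (monicPoly μ n) : ℂ)‖ ≤ B)
    (hlim : ∀ ζ : Circle, Tendsto
      (fun n => (reversedPoly μ n).eval (ζ : ℂ) / (polyNorm μ (monicPoly μ n) : ℂ)) atTop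
      (𝓝 (g ζ))) :
    μ.withDensity (fun ζ => ENNReal.ofReal (‖g ζ‖ ^ 2)) = arcMeasure := by
  set φ : ℕ → Circle → ℂ := fun n ζ =>
    (reversedPoly μ n).eval (ζ : ℂ) / (polyNorm μ (monicPoly μ n) : ℂ) with hφ
  have hφc (n : ℕ) : Continuous (φ n) := (continuous_eval_circle _).div_const _
  -- The integral is the limit of `⟨zᵏ φₙ*, φₙ₊ₖ*⟩`, which is exact for every `n`: the shift by `k`
  -- keeps `zᵏ φₙ*` in the span of `zᵏ, …, zⁿ⁺ᵏ`, orthogonal to `φₙ₊ₖ*` when `k ≥ 1`.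
  have hmom (k : ℕ) : ∫ ζ : Circle, conj ((ζ : ℂ) ^ k * g ζ) * g ζ ∂μ = if k = 0 then 1 else 0 := by
    have hl : Tendsto (fun n => ∫ ζ : Circle, conj ((ζ : ℂ) ^ k * φ n ζ) * φ (n + k) ζ ∂μ) atTop
        (𝓝 (∫ ζ : Circle, conj ((ζ : ℂ) ^ k * g ζ) * g ζ ∂μ)) := by
      refine tendsto_integral_of_dominated_convergence (fun _ => B * B) (fun n => ?_)
        (integrable_const _) (fun n => ae_of_all _ fun ζ => ?_) (ae_of_all _ fun ζ => ?_)
      · have h1 := hφc n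
        have h2 := hφc (n + k)
        exact Continuous.aestronglyMeasurable (by fun_prop)
      · rw [norm_mul, RCLike.norm_conj, norm_mul, norm_pow, Circle.norm_coe, one_pow, one_mul]
        exact mul_le_mul (hB n ζ) (hB (n + k) ζ) (norm_nonneg _) ((norm_nonneg _).trans (hB n ζ))
      · exact ((Complex.continuous_conj.tendsto _).comp ((hlim ζ).const_mul _)).mul
          ((hlim ζ).comp (tendsto_add_atTop_nat k))
    refine tendsto_nhds_unique hl (tendsto_const_nhds.congr fun n => ?_)
    have hval : ∫ ζ : Circle, conj ((ζ : ℂ) ^ k * φ n ζ) * φ (n + k) ζ ∂μ =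
        polyInner μ (X ^ k * reversedPoly μ n) (reversedPoly μ (n + k)) /
          (polyNorm μ (monicPoly μ n) * polyNorm μ (monicPoly μ (n + k)) : ℂ) := by
      rw [polyInner, ← integral_div]
      congr 1; ext ζ
      simp only [hφ, eval_mul, eval_pow, eval_X, map_mul, map_div₀, Complex.conj_ofReal]
      ring
    rw [hval]
    rcases Nat.eq_zero_or_pos k with rfl | hk
    · have hN : (polyNorm μ (monicPoly μ n) : ℂ) ≠ 0 := by
        exact_mod_cast (polyNorm_pos hμ (monicPoly_monic μ n).ne_zero).ne'
      rw [if_pos rfl, pow_zero, one_mul, add_zero, polyInner_self, polyNorm_reversedPoly hμ]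
      push_cast
      field_simp
    · rw [polyInner_X_pow_mul_reversedPoly hμ hk, zero_div, if_neg hk.ne']
  have hgm : Measurable fun ζ => ENNReal.ofReal (‖g ζ‖ ^ 2) := by
    have := hg.measurable
    fun_prop
  have hfin : IsFiniteMeasure (μ.withDensity (fun ζ => ENNReal.ofReal (‖g ζ‖ ^ 2))) :=
    isFiniteMeasure_withDensity_ofReal
      (integrable_of_continuous μ (f := fun ζ => ‖g ζ‖ ^ 2) (by fun_prop)).2
  refine ext_of_moments fun k => ?_
  rw [integral_pow_arcMeasure, integral_withDensity_eq_integral_toReal_smul hgm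
    (ae_of_all _ fun _ => ENNReal.ofReal_lt_top)]
  have hc := congrArg conj (hmom k)
  rw [← integral_conj, apply_ite conj, map_one, map_zero] at hc
  rw [← hc]
  congr 1; ext ζ
  rw [ENNReal.toReal_ofReal (by positivity), Complex.real_smul, ← Complex.normSq_eq_norm_sq,
    Complex.normSq_eq_conj_mul_self]
  simp only [map_mul, map_pow, Complex.conj_conj]
  ring

end Limit

/-! ### Elementary estimates. -/

/-- With `u = Φₙ*`, `w = z Φₙ`, `a = αₙ`, this shows that one recursion step preserves `|Φₙ| ≤
|Φₙ*|`. -/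
lemma norm_sq_sub_sub_norm_sq_sub (a u w : ℂ) :
    ‖u - a * w‖ ^ 2 - ‖w - conj a * u‖ ^ 2 = (1 - ‖a‖ ^ 2) * (‖u‖ ^ 2 - ‖w‖ ^ 2) := by
  simp only [← Complex.normSq_eq_norm_sq, Complex.normSq_apply, Complex.sub_re, Complex.sub_im,
    Complex.mul_re, Complex.mul_im, Complex.conj_re, Complex.conj_im]
  ring

lemma norm_exp_sub_exp_le (u v : ℂ) :
    ‖Complex.exp u - Complex.exp v‖ ≤ Real.exp ‖v‖ * (‖u - v‖ * Real.exp ‖u - v‖) := by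
  have h1 : Complex.exp u - Complex.exp v = Complex.exp v * (Complex.exp (u - v) - 1) := by
    rw [mul_sub, ← Complex.exp_add]; ring_nf
  have h2 := Complex.norm_exp_sub_sum_le_norm_mul_exp (u - v) 1
  simp only [Finset.range_one, Finset.sum_singleton, pow_zero, Nat.factorial_zero, Nat.cast_one,
    div_one, pow_one] at h2
  rw [h1, norm_mul]
  exact mul_le_mul (Complex.norm_exp_le_exp_norm v) h2 (norm_nonneg _) (Real.exp_pos _).le

lemma norm_log_one_add_le_mul {r : ℝ} (hr : r < 1) {w : ℂ} (hw : ‖w‖ ≤ r) :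
    ‖Complex.log (1 + w)‖ ≤ ((1 - r)⁻¹ + 1) * ‖w‖ := by
  have h := Complex.norm_log_one_add_le (hw.trans_lt hr)
  have h1 : (1 - ‖w‖)⁻¹ ≤ (1 - r)⁻¹ := inv_anti₀ (by linarith) (by linarith)
  have h2 : (0 : ℝ) ≤ (1 - ‖w‖)⁻¹ := inv_nonneg.2 (by linarith)
  have h3 : ‖w‖ ^ 2 * (1 - ‖w‖)⁻¹ ≤ ‖w‖ * (1 - r)⁻¹ :=
    mul_le_mul (by nlinarith [norm_nonneg w]) h1 h2 (norm_nonneg _)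
  have h4 : 0 ≤ ‖w‖ ^ 2 * (1 - ‖w‖)⁻¹ := by positivity
  linarith

/-! ### Logarithms of the normalized reversed polynomials. -/

section SchurRatio

variable (μ : Measure Circle)

/-- The ratio `αₙ z Φₙ(z) / Φₙ*(z)`, so that `Φₙ₊₁* = (1 - ratio) Φₙ*`. -/
noncomputable def schurRatio (n : ℕ) (z : ℂ) : ℂ :=
  verblunsky μ n * (z * (monicPoly μ n).eval z) / (reversedPoly μ n).eval z

/-- The logarithm of the quotient `φₙ₊₁*(z) / φₙ*(z)`. -/
noncomputable def logTerm (n : ℕ) (z : ℂ) : ℂ :=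
  Complex.log (1 - schurRatio μ n z) - ((Real.log (1 - ‖verblunsky μ n‖ ^ 2) / 2 : ℝ) : ℂ)

lemma im_logTerm_zero (n : ℕ) : (logTerm μ n 0).im = 0 := by
  rw [logTerm, Complex.sub_im, Complex.ofReal_im]
  simp [schurRatio]

variable {μ}

lemma polyNorm_monicPoly_succ [IsFiniteMeasure μ] (hμ : Nontrivial μ) (n : ℕ) :
    polyNorm μ (monicPoly μ (n + 1)) =
      polyNorm μ (monicPoly μ n) * Real.exp (Real.log (1 - ‖verblunsky μ n‖ ^ 2) / 2) := by
  have hlt := norm_verblunsky_lt_one hμ n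
  have h0 : 0 < 1 - ‖verblunsky μ n‖ ^ 2 := by nlinarith [norm_nonneg (verblunsky μ n)]
  have h1 := polyNorm_pos hμ (monicPoly_monic μ n).ne_zero
  have h2 := polyNorm_pos hμ (monicPoly_monic μ (n + 1)).ne_zero
  refine (pow_left_inj₀ h2.le (by positivity) two_ne_zero).1 ?_
  rw [polyNorm_monicPoly_succ_sq hμ, mul_pow, ← Real.exp_nat_mul, Nat.cast_two, mul_div_cancel₀ _
    two_ne_zero, Real.exp_log h0, mul_comm]

lemma polyNorm_monicPoly_le_one [IsProbabilityMeasure μ] (hμ : Nontrivial μ) (n : ℕ) :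
    polyNorm μ (monicPoly μ n) ≤ 1 := by
  induction n with
  | zero => simp [monicPoly_zero, polyNorm]
  | succ n ih =>
    have h1 := polyNorm_pos hμ (monicPoly_monic μ n).ne_zero
    have h2 := polyNorm_monicPoly_succ_sq hμ n
    nlinarith [mul_nonneg (sq_nonneg ‖verblunsky μ n‖) (sq_nonneg (polyNorm μ (monicPoly μ n))),
      polyNorm_pos hμ (monicPoly_monic μ (n + 1)).ne_zero]

variable [IsFiniteMeasure μ]

/-- The two claims are proved jointly: `|z Φₙ| ≤ |Φₙ*| ≠ 0` and `|αₙ| < 1` keep `Φₙ₊₁*` away from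
zero. -/
lemma norm_eval_monicPoly_le (hμ : Nontrivial μ) (n : ℕ) {z : ℂ} (hz : ‖z‖ ≤ 1) :
    ‖(monicPoly μ n).eval z‖ ≤ ‖(reversedPoly μ n).eval z‖ ∧ (reversedPoly μ n).eval z ≠ 0 := by
  induction n with
  | zero => simp [monicPoly_zero, reversedPoly]
  | succ n ih =>
    obtain ⟨hle, hne⟩ := ih
    have ha := norm_verblunsky_lt_one hμ n
    have hpos := norm_pos_iff.2 hne
    set u := (reversedPoly μ n).eval z
    set w := z * (monicPoly μ n).eval z with hw
    have hwu : ‖w‖ ≤ ‖u‖ := by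
      rw [hw, norm_mul]
      exact (mul_le_of_le_one_left (norm_nonneg _) hz).trans hle
    have e1 : (reversedPoly μ (n + 1)).eval z = u - verblunsky μ n * w := by
      simp [reversedPoly, u, w]
    have e2 : (monicPoly μ (n + 1)).eval z = w - conj (verblunsky μ n) * u := by
      simp [szego_recursion hμ, u, w]
    rw [e1, e2]
    constructor
    · have h := norm_sq_sub_sub_norm_sq_sub (verblunsky μ n) u w
      have h1 : 0 ≤ (1 - ‖verblunsky μ n‖ ^ 2) * (‖u‖ ^ 2 - ‖w‖ ^ 2) :=
        mul_nonneg (by nlinarith [norm_nonneg (verblunsky μ n)])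
          (by nlinarith [norm_nonneg w])
      exact le_of_sq_le_sq (by linarith) (norm_nonneg _)
    · intro h
      have h1 : ‖u‖ = ‖verblunsky μ n‖ * ‖w‖ := by rw [sub_eq_zero.1 h, norm_mul]
      nlinarith [norm_nonneg (verblunsky μ n), norm_nonneg w]

lemma norm_schurRatio_le (hμ : Nontrivial μ) (n : ℕ) {z : ℂ} (hz : ‖z‖ ≤ 1) :
    ‖schurRatio μ n z‖ ≤ ‖verblunsky μ n‖ := by
  obtain ⟨hle, hne⟩ := norm_eval_monicPoly_le hμ n hz
  rw [schurRatio, norm_div, norm_mul, norm_mul, div_le_iff₀ (norm_pos_iff.2 hne)]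
  exact mul_le_mul_of_nonneg_left
    ((mul_le_of_le_one_left (norm_nonneg _) hz).trans hle) (norm_nonneg _)

lemma one_sub_schurRatio_mem_slitPlane (hμ : Nontrivial μ) (n : ℕ) {z : ℂ} (hz : ‖z‖ ≤ 1) :
    1 - schurRatio μ n z ∈ Complex.slitPlane := by
  rw [sub_eq_add_neg]
  refine Complex.mem_slitPlane_of_norm_lt_one ?_
  rw [norm_neg]
  exact (norm_schurRatio_le hμ n hz).trans_lt (norm_verblunsky_lt_one hμ n)

lemma differentiableOn_schurRatio (hμ : Nontrivial μ) (n : ℕ) :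
    DifferentiableOn ℂ (schurRatio μ n) (Metric.closedBall 0 1) := by
  refine DifferentiableOn.div ?_ (reversedPoly μ n).differentiable.differentiableOn
    fun z hz => (norm_eval_monicPoly_le hμ n (by simpa using hz)).2
  exact ((differentiable_id.mul (monicPoly μ n).differentiable).const_mul _).differentiableOn

lemma differentiableOn_logTerm (hμ : Nontrivial μ) (n : ℕ) :
    DifferentiableOn ℂ (logTerm μ n) (Metric.closedBall 0 1) :=
  (((differentiableOn_schurRatio hμ n).const_sub 1).clog fun _ hz =>
    one_sub_schurRatio_mem_slitPlane hμ n (by simpa using hz)).sub_const _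

lemma exp_sum_logTerm {μ : Measure Circle} [IsProbabilityMeasure μ] (hμ : Nontrivial μ) (n : ℕ)
    {z : ℂ} (hz : ‖z‖ ≤ 1) :
    Complex.exp (∑ k ∈ Finset.range n, logTerm μ k z) =
      (reversedPoly μ n).eval z / (polyNorm μ (monicPoly μ n) : ℂ) := by
  induction n with
  | zero => simp [reversedPoly, monicPoly_zero, polyNorm]
  | succ n ih =>
    have hne := (norm_eval_monicPoly_le hμ n hz).2
    have hN : (polyNorm μ (monicPoly μ n) : ℂ) ≠ 0 := by
      exact_mod_cast (polyNorm_pos hμ (monicPoly_monic μ n).ne_zero).ne'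
    rw [Finset.sum_range_succ, Complex.exp_add, ih, logTerm, Complex.exp_sub,
      Complex.exp_log (Complex.slitPlane_ne_zero (one_sub_schurRatio_mem_slitPlane hμ n hz)),
      polyNorm_monicPoly_succ hμ]
    simp only [reversedPoly, schurRatio, eval_sub, eval_mul, eval_C, eval_X, Complex.ofReal_mul,
      Complex.ofReal_exp]
    have hE := Complex.exp_ne_zero ((Real.log (1 - ‖verblunsky μ n‖ ^ 2) / 2 : ℝ) : ℂ)
    field_simp

lemma exists_norm_verblunsky_le (hμ : Nontrivial μ) (h : Tendsto (verblunsky μ) atTop (𝓝 0)) :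
    ∃ r < 1, ∀ n, ‖verblunsky μ n‖ ≤ r := by
  -- The values together with their limit `0` form a compact set, so the supremum of the norms is
  -- attained and is itself below `1`.
  obtain ⟨x, hx, hmax⟩ := h.isCompact_insert_range.exists_isMaxOn (Set.insert_nonempty _ _)
    continuous_norm.continuousOn
  refine ⟨‖x‖, ?_, fun n => hmax (Set.mem_insert_of_mem _ ⟨n, rfl⟩)⟩
  rcases hx with rfl | ⟨n, rfl⟩
  · simp
  · exact norm_verblunsky_lt_one hμ n

lemma norm_logTerm_le (hμ : Nontrivial μ) {r : ℝ} (hr : r < 1)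
    (hα : ∀ n, ‖verblunsky μ n‖ ≤ r) (n : ℕ) {z : ℂ} (hz : ‖z‖ ≤ 1) :
    ‖logTerm μ n z‖ ≤ 2 * ((1 - r)⁻¹ + 1) * ‖verblunsky μ n‖ := by
  have hn := hα n
  have h0 := norm_nonneg (verblunsky μ n)
  have hc : 0 ≤ (1 - r)⁻¹ + 1 := by
    have : 0 ≤ (1 - r)⁻¹ := inv_nonneg.2 (by linarith)
    linarith
  have h1 : ‖Complex.log (1 - schurRatio μ n z)‖ ≤ ((1 - r)⁻¹ + 1) * ‖verblunsky μ n‖ := by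
    have hs := norm_schurRatio_le hμ n hz
    rw [sub_eq_add_neg]
    refine (norm_log_one_add_le_mul hr (by rw [norm_neg]; exact hs.trans hn)).trans ?_
    rw [norm_neg]
    exact mul_le_mul_of_nonneg_left hs hc
  have hsq : ‖verblunsky μ n‖ ^ 2 ≤ ‖verblunsky μ n‖ := by nlinarith
  have h2 : ‖((Real.log (1 - ‖verblunsky μ n‖ ^ 2) / 2 : ℝ) : ℂ)‖ ≤
      ((1 - r)⁻¹ + 1) * ‖verblunsky μ n‖ := by
    have he : ((Real.log (1 - ‖verblunsky μ n‖ ^ 2) / 2 : ℝ) : ℂ) =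
        Complex.log (1 + -((‖verblunsky μ n‖ ^ 2 : ℝ) : ℂ)) / 2 := by
      rw [Complex.ofReal_div, Complex.ofReal_log (by nlinarith)]
      push_cast
      ring_nf
    have hnorm : ‖-((‖verblunsky μ n‖ ^ 2 : ℝ) : ℂ)‖ = ‖verblunsky μ n‖ ^ 2 := by
      rw [norm_neg, Complex.norm_real, Real.norm_of_nonneg (by positivity)]
    have := norm_log_one_add_le_mul hr (w := -((‖verblunsky μ n‖ ^ 2 : ℝ) : ℂ))
      (by rw [hnorm]; linarith)
    rw [hnorm] at this
    rw [he, norm_div, Complex.norm_two]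
    have h3 := mul_le_mul_of_nonneg_left hsq hc
    have h4 := mul_nonneg hc h0
    linarith
  refine (norm_sub_le _ _).trans ?_
  linarith

end SchurRatio

/-- For exponentially decaying Verblunsky coefficients the normalized reversed polynomials converge
exponentially fast on the closed disc to the exponential of a function `h` of the disc algebra. -/
theorem exists_log_szego {μ : Measure Circle} [IsProbabilityMeasure μ] (hμ : Nontrivial μ)
    {b K : ℝ} (hb0 : 0 < b) (hb1 : b < 1) (hα : ∀ n, ‖verblunsky μ n‖ ≤ K * b ^ n) :
    ∃ (h : ℂ → ℂ) (M : ℝ), DiffContOnCl ℂ h (Metric.ball 0 1) ∧ (h 0).im = 0 ∧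
      ∀ n z, ‖z‖ ≤ 1 → ‖(reversedPoly μ n).eval z / (polyNorm μ (monicPoly μ n) : ℂ) -
        Complex.exp (h z)‖ ≤ M * b ^ n := by
  have hK : 0 ≤ K := by simpa using (norm_nonneg _).trans (hα 0)
  have hα0 : Tendsto (verblunsky μ) atTop (𝓝 0) := by
    refine squeeze_zero_norm hα ?_
    simpa using (tendsto_pow_atTop_nhds_zero_of_lt_one hb0.le hb1).const_mul K
  obtain ⟨r, hr, hαr⟩ := exists_norm_verblunsky_le hμ hα0
  obtain ⟨L, hL0, hL⟩ : ∃ L : ℝ, 0 ≤ L ∧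
      ∀ n (z : ℂ), ‖z‖ ≤ 1 → ‖logTerm μ n z‖ ≤ L * b ^ n := by
    have hc : 0 ≤ 2 * ((1 - r)⁻¹ + 1) := by
      have : 0 ≤ (1 - r)⁻¹ := inv_nonneg.2 (by linarith)
      linarith
    refine ⟨2 * ((1 - r)⁻¹ + 1) * K, mul_nonneg hc hK, fun n z hz => ?_⟩
    rw [mul_assoc]
    exact (norm_logTerm_le hμ hr hαr n hz).trans (mul_le_mul_of_nonneg_left (hα n) hc)
  have hsum : Summable fun n => L * b ^ n := (summable_geometric_of_lt_one hb0.le hb1).mul_left L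
  have htail (n : ℕ) (z : ℂ) (hz : ‖z‖ ≤ 1) :
      ‖∑ k ∈ Finset.range n, logTerm μ k z - ∑' k, logTerm μ k z‖ ≤ L * (1 - b)⁻¹ * b ^ n := by
    have hs : Summable fun k => logTerm μ k z := hsum.of_norm_bounded fun k => hL k z hz
    rw [← hs.sum_add_tsum_nat_add n, sub_add_cancel_left, norm_neg]
    refine tsum_of_norm_bounded (g := fun k => L * b ^ n * b ^ k) ?_ fun k => ?_
    · have := (hasSum_geometric_of_lt_one hb0.le hb1).mul_left (L * b ^ n)
      rwa [mul_right_comm] at this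
    · refine (hL _ z hz).trans_eq ?_
      rw [pow_add]; ring
  set T := L * (1 - b)⁻¹ with hT
  have hT0 : 0 ≤ T := mul_nonneg hL0 (inv_nonneg.2 (by linarith))
  -- `T` bounds both `|h|` and every tail; each accounts for one exponential factor in
  -- `norm_exp_sub_exp_le`.
  refine ⟨fun z => ∑' k, logTerm μ k z, Real.exp T * Real.exp T * T, ⟨?_, ?_⟩, ?_,
    fun n z hz => ?_⟩
  · exact Complex.differentiableOn_tsum_of_summable_norm hsum
      (fun n => (differentiableOn_logTerm hμ n).mono Metric.ball_subset_closedBall)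
      Metric.isOpen_ball fun n z hz => hL n z (by simpa using (Metric.ball_subset_closedBall hz))
  · rw [closure_ball 0 one_ne_zero]
    exact continuousOn_tsum (fun n => (differentiableOn_logTerm hμ n).continuousOn) hsum
      fun n z hz => hL n z (by simpa using hz)
  · have hs : Summable fun k => logTerm μ k 0 :=
      hsum.of_norm_bounded fun k => hL k 0 (by simp)
    rw [Complex.im_tsum hs]
    simp [im_logTerm_zero]
  · rw [← exp_sum_logTerm hμ n hz]
    refine (norm_exp_sub_exp_le _ _).trans ?_
    have h0 := htail 0 z hz
    rw [Finset.sum_range_zero, zero_sub, norm_neg, pow_zero, mul_one] at h0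
    have h1 := htail n z hz
    have h2 : T * b ^ n ≤ T := mul_le_of_le_one_right hT0 (pow_le_one₀ hb0.le hb1.le)
    calc
      _ ≤ Real.exp T * (T * b ^ n * Real.exp T) := by
        gcongr
        exact h1.trans h2
      _ = _ := by ring

/-! ### Szegő asymptotics. -/

section Asymptotics

variable {μ : Measure Circle} [IsProbabilityMeasure μ]

/-- Szegő asymptotics with an exponential rate for exponentially decaying Verblunsky
coefficients. -/
theorem szego_asymptotics (hμ : Nontrivial μ) {b K : ℝ} (hb0 : 0 < b) (hb1 : b < 1)
    (hα : ∀ n, ‖verblunsky μ n‖ ≤ K * b ^ n) :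
    SzegoCondition μ ∧ ∃ M : ℝ, ∀ n z, ‖z‖ < 1 →
      ‖(reversedPoly μ n).eval z / (polyNorm μ (monicPoly μ n) : ℂ) - (szegoFunction μ z)⁻¹‖ ≤
        M * b ^ n := by
  obtain ⟨h, M, hh, h0, hM⟩ := exists_log_szego hμ hb0 hb1 hα
  have hM0 : 0 ≤ M := by simpa using (norm_nonneg _).trans (hM 0 0 (by simp))
  have hpow : Tendsto (fun n => M * b ^ n) atTop (𝓝 0) := by
    simpa using (tendsto_pow_atTop_nhds_zero_of_lt_one hb0.le hb1).const_mul M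
  have hcont := continuous_circle_of_diffContOnCl hh
  have hcirc (ζ : Circle) : ‖(ζ : ℂ)‖ ≤ 1 := (Circle.norm_coe ζ).le
  have hlim (ζ : Circle) : Tendsto
      (fun n => (reversedPoly μ n).eval (ζ : ℂ) / (polyNorm μ (monicPoly μ n) : ℂ)) atTop
      (𝓝 (Complex.exp (h ζ))) :=
    tendsto_iff_norm_sub_tendsto_zero.2
      (squeeze_zero (fun _ => norm_nonneg _) (fun n => hM n ζ (hcirc ζ)) hpow)
  -- The estimate at `n = 0`, where the polynomial is `1`, gives `|exp h| ≤ M + 1`; the estimate at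
  -- `n` adds another `M`.
  have hB (n : ℕ) (ζ : Circle) :
      ‖(reversedPoly μ n).eval (ζ : ℂ) / (polyNorm μ (monicPoly μ n) : ℂ)‖ ≤ M + (M + 1) := by
    have h1 := hM 0 ζ (hcirc ζ)
    have h2 := hM n ζ (hcirc ζ)
    have h3 : M * b ^ n ≤ M := mul_le_of_le_one_right hM0 (pow_le_one₀ hb0.le hb1.le)
    have h4 : ‖Complex.exp (h ζ)‖ ≤ M + 1 := by
      have h5 : (reversedPoly μ 0).eval (ζ : ℂ) / (polyNorm μ (monicPoly μ 0) : ℂ) = 1 := by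
        simp [reversedPoly, monicPoly_zero, polyNorm]
      rw [h5, pow_zero, mul_one, norm_sub_rev] at h1
      have := norm_le_norm_sub_add (Complex.exp (h ζ)) 1
      rw [norm_one] at this
      linarith
    have := norm_le_norm_sub_add
      ((reversedPoly μ n).eval (ζ : ℂ) / (polyNorm μ (monicPoly μ n) : ℂ)) (Complex.exp (h ζ))
    linarith
  have hden := withDensity_eq_arcMeasure hμ (Complex.continuous_exp.comp hcont) hB hlim
  obtain ⟨hS, hD⟩ := szego_of_boundary (μ := μ) hh h0 (by
    rw [← hden]
    congr 1; ext ζ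
    rw [Function.comp_apply, Complex.norm_exp, ← Real.exp_nat_mul, Nat.cast_two])
  refine ⟨hS, M, fun n z hz => ?_⟩
  rw [hD z hz, ← Complex.exp_neg, neg_neg]
  exact hM n z hz.le

end Asymptotics

/-! ### The rescaled recursion and perturbed contractions. -/

lemma szegoFunction_ne_zero (μ : Measure Circle) (z : ℂ) : szegoFunction μ z ≠ 0 :=
  Complex.exp_ne_zero _

/-- The subtracted term is the fixed point of `v ↦ (z/b) v - b⁻¹ conj C G`, the limiting form of the
recursion for `b⁻ⁿ Φₙ(z)` when `Φₙ*(z) → G`. -/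
lemma rescaled_recursion {μ : Measure Circle} [IsFiniteMeasure μ] (hμ : Nontrivial μ)
    {b : ℝ} (hb0 : 0 < b) (C : ℂ)
    {z : ℂ} (hz : ‖z‖ < b) (G : ℂ) (n : ℕ) :
    ((b : ℂ) ^ (n + 1))⁻¹ * (monicPoly μ (n + 1)).eval z - conj C * (z - b)⁻¹ * G =
      z / b * (((b : ℂ) ^ n)⁻¹ * (monicPoly μ n).eval z - conj C * (z - b)⁻¹ * G) -
        (b : ℂ)⁻¹ * (conj (((b : ℂ) ^ n)⁻¹ * verblunsky μ n) * (reversedPoly μ n).eval z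
          - conj C * G) := by
  have hb : (b : ℂ) ≠ 0 := by exact_mod_cast hb0.ne'
  have hzb : z - b ≠ 0 := by
    intro h
    rw [sub_eq_zero.1 h, Complex.norm_real, Real.norm_of_nonneg hb0.le] at hz
    exact lt_irrefl _ hz
  rw [szego_recursion hμ]
  simp only [eval_sub, eval_mul, eval_C, eval_X, map_mul, map_inv₀, map_pow, Complex.conj_ofReal]
  field_simp
  ring

lemma mul_orthonormalPoly_sub (μ : Measure Circle) (c L : ℂ) {N : ℂ}
    (hN : N ≠ 0) (n : ℕ) (z : ℂ) :
    c * orthonormalPoly μ n z - L =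
      (c * (monicPoly μ n).eval z - L * N) * (polyNorm μ (monicPoly μ n) : ℂ)⁻¹ +
        L * N * ((polyNorm μ (monicPoly μ n) : ℂ)⁻¹ - N⁻¹) := by
  rw [orthonormalPoly]
  field_simp
  ring

lemma le_pow_mul_add_of_recursion {x : ℕ → ℝ} {q ε : ℝ} (hq0 : 0 ≤ q)
    (h : ∀ n, x (n + 1) ≤ q * x n + (1 - q) * ε) (hε : 0 ≤ ε) (n : ℕ) :
    x n ≤ q ^ n * x 0 + ε := by
  induction n with
  | zero => simpa using hε
  | succ n ih =>
    have h1 := h n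
    have h2 := mul_le_mul_of_nonneg_left ih hq0
    rw [pow_succ]
    linarith

lemma tendsto_zero_of_recursion {x d : ℕ → ℝ} {q : ℝ} (hx : ∀ n, 0 ≤ x n) (hq0 : 0 ≤ q)
    (hq1 : q < 1) (h : ∀ n, x (n + 1) ≤ q * x n + d n) (hd : Tendsto d atTop (𝓝 0)) :
    Tendsto x atTop (𝓝 0) := by
  refine tendsto_order.2 ⟨fun a ha => Eventually.of_forall fun n => ha.trans_le (hx n),
    fun ε hε => ?_⟩
  obtain ⟨m, hm⟩ := eventually_atTop.1
    (hd.eventually (ge_mem_nhds (by nlinarith : 0 < (1 - q) * (ε / 2))))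
  have h1 (n : ℕ) : x (m + n) ≤ q ^ n * x m + ε / 2 :=
    le_pow_mul_add_of_recursion (x := fun n => x (m + n)) hq0
      (fun n => (h (m + n)).trans (by gcongr; exact hm _ (Nat.le_add_right m n))) (by linarith) n
  have h2 : Tendsto (fun n => q ^ n * x m) atTop (𝓝 0) := by
    simpa using (tendsto_pow_atTop_nhds_zero_of_lt_one hq0 hq1).mul_const (x m)
  obtain ⟨k, hk⟩ := eventually_atTop.1 (h2.eventually (gt_mem_nhds (half_pos hε)))
  filter_upwards [eventually_ge_atTop (m + k)] with n hn
  obtain ⟨j, rfl⟩ := Nat.exists_eq_add_of_le hn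
  have h3 := hk (k + j) (Nat.le_add_right k j)
  have h4 := h1 (k + j)
  rw [← add_assoc] at h4
  linarith

/-- The condition on `B` makes `B sⁿ` a supersolution. The separate bound `p` for `q` lets one `B`
serve all `z` at once. -/
lemma le_geometric_of_recursion {x : ℕ → ℝ} {q r s A B : ℝ} (hA : 0 ≤ A) (hr0 : 0 ≤ r)
    (hrs : r ≤ s) (hq : ∀ n, x (n + 1) ≤ q * x n + A * r ^ n) (hx : ∀ n, 0 ≤ x n)
    {p : ℝ} (hqp : q ≤ p) (hp0 : 0 ≤ p) (h0 : x 0 ≤ B) (hB : A ≤ (s - p) * B)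
    (n : ℕ) : x n ≤ B * s ^ n := by
  induction n with
  | zero => simpa using h0
  | succ n ih =>
    have h1 : A * r ^ n ≤ A * s ^ n := by gcongr
    have h2 : q * x n ≤ p * x n := mul_le_mul_of_nonneg_right hqp (hx n)
    have h3 : p * x n ≤ p * (B * s ^ n) := mul_le_mul_of_nonneg_left ih hp0
    have h4 : A * s ^ n ≤ (s - p) * B * s ^ n :=
      mul_le_mul_of_nonneg_right hB (pow_nonneg (hr0.trans hrs) n)
    have h5 := hq n
    rw [pow_succ]
    linarith

/-! ### The two asymptotic statements. -/

section Rescaled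

variable {μ : Measure Circle}

/-- Since `Φₙ*(0) = 1`, the value `φₙ*(0)` is `1 / ‖Φₙ‖`. -/
lemma norm_polyNorm_inv_sub_le {b M : ℝ}
    (hM : ∀ n z, ‖z‖ < 1 → ‖(reversedPoly μ n).eval z / (polyNorm μ (monicPoly μ n) : ℂ) -
      (szegoFunction μ z)⁻¹‖ ≤ M * b ^ n) (n : ℕ) :
    ‖(polyNorm μ (monicPoly μ n) : ℂ)⁻¹ - (szegoFunction μ 0)⁻¹‖ ≤ M * b ^ n := by
  have := hM n 0 (by simp)
  rwa [eval_zero_reversedPoly, one_div] at this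

variable [IsProbabilityMeasure μ]

lemma norm_reversedPoly_sub_le (hμ : Nontrivial μ) {b M : ℝ}
    (hM : ∀ n z, ‖z‖ < 1 → ‖(reversedPoly μ n).eval z / (polyNorm μ (monicPoly μ n) : ℂ) -
      (szegoFunction μ z)⁻¹‖ ≤ M * b ^ n) (n : ℕ) {z : ℂ} (hz : ‖z‖ < 1) :
    ‖(reversedPoly μ n).eval z - (szegoFunction μ z)⁻¹ * szegoFunction μ 0‖ ≤
      (M + ‖szegoFunction μ 0‖ * M * ‖(szegoFunction μ z)⁻¹‖) * b ^ n := by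
  have hNpos := polyNorm_pos hμ (monicPoly_monic μ n).ne_zero
  have hN0 : (polyNorm μ (monicPoly μ n) : ℂ) ≠ 0 := by exact_mod_cast hNpos.ne'
  have hN1 : ‖(polyNorm μ (monicPoly μ n) : ℂ)‖ ≤ 1 := by
    rw [Complex.norm_real, Real.norm_of_nonneg hNpos.le]
    exact polyNorm_monicPoly_le_one hμ n
  have hD := szegoFunction_ne_zero μ 0
  have h1 := hM n z hz
  have h2 := norm_polyNorm_inv_sub_le hM n
  set N : ℂ := (polyNorm μ (monicPoly μ n) : ℂ)
  set D := szegoFunction μ 0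
  set g := (szegoFunction μ z)⁻¹
  have he : (reversedPoly μ n).eval z - g * D =
      N * ((reversedPoly μ n).eval z / N - g) - N * (D * (N⁻¹ - D⁻¹) * g) := by
    field_simp
    ring
  rw [he]
  refine (norm_sub_le _ _).trans ?_
  rw [norm_mul N, norm_mul N, norm_mul (D * _), norm_mul D]
  have h3 : ‖N‖ * ‖(reversedPoly μ n).eval z / N - g‖ ≤ M * b ^ n :=
    (mul_le_of_le_one_left (norm_nonneg _) hN1).trans h1
  have h4 : ‖N‖ * (‖D‖ * ‖N⁻¹ - D⁻¹‖ * ‖g‖) ≤ ‖D‖ * (M * b ^ n) * ‖g‖ :=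
    (mul_le_of_le_one_left (by positivity) hN1).trans (by gcongr)
  linarith

lemma tendsto_of_norm_sub_le_geometric {u : ℕ → ℂ} {L : ℂ} {b M : ℝ} (hb0 : 0 < b) (hb1 : b < 1)
    (h : ∀ n, ‖u n - L‖ ≤ M * b ^ n) : Tendsto u atTop (𝓝 L) := by
  refine tendsto_iff_norm_sub_tendsto_zero.2 (squeeze_zero (fun _ => norm_nonneg _) h ?_)
  simpa using (tendsto_pow_atTop_nhds_zero_of_lt_one hb0.le hb1).const_mul M

theorem tendsto_orthonormalPoly (hμ : Nontrivial μ) {b : ℝ} (hb0 : 0 < b) (hb1 : b < 1) {C : ℂ}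
    (hC : Tendsto (fun n : ℕ => ((b : ℂ) ^ n)⁻¹ * verblunsky μ n) atTop (𝓝 C)) :
    SzegoCondition μ ∧ ∀ z : ℂ, ‖z‖ < b →
      Tendsto (fun n : ℕ => ((b : ℂ) ^ n)⁻¹ * orthonormalPoly μ n z) atTop
        (𝓝 (conj C * (z - (b : ℂ))⁻¹ * (szegoFunction μ z)⁻¹)) := by
  have hα : ∃ K : ℝ, ∀ n, ‖verblunsky μ n‖ ≤ K * b ^ n := by
    obtain ⟨K, hK⟩ := hC.norm.bddAbove_range
    refine ⟨K, fun n => ?_⟩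
    have h : ‖((b : ℂ) ^ n)⁻¹ * verblunsky μ n‖ ≤ K := hK ⟨n, rfl⟩
    rw [norm_mul, norm_inv, norm_pow, Complex.norm_real, Real.norm_of_nonneg hb0.le] at h
    have hp := pow_pos hb0 n
    rwa [inv_mul_le_iff₀ hp, mul_comm] at h
  obtain ⟨K, hα⟩ := hα
  obtain ⟨hS, M, hM⟩ := szego_asymptotics hμ hb0 hb1 hα
  refine ⟨hS, fun z hz => ?_⟩
  have hz1 := hz.trans hb1
  have hD := szegoFunction_ne_zero μ 0
  have hrev : Tendsto (fun n => (reversedPoly μ n).eval z) atTop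
      (𝓝 ((szegoFunction μ z)⁻¹ * szegoFunction μ 0)) :=
    tendsto_of_norm_sub_le_geometric hb0 hb1 fun n => norm_reversedPoly_sub_le hμ hM n hz1
  have hNinv := tendsto_of_norm_sub_le_geometric hb0 hb1 (norm_polyNorm_inv_sub_le hM)
  set G := (szegoFunction μ z)⁻¹ * szegoFunction μ 0 with hG
  have hd : Tendsto (fun n => ‖(b : ℂ)⁻¹ * (conj (((b : ℂ) ^ n)⁻¹ * verblunsky μ n) *
      (reversedPoly μ n).eval z - conj C * G)‖) atTop (𝓝 0) := by
    have h1 := (((Complex.continuous_conj.tendsto C).comp hC).mul hrev).sub_const (conj C * G)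
    have h2 := (h1.const_mul (b : ℂ)⁻¹).norm
    rw [sub_self, mul_zero, norm_zero] at h2
    exact h2
  have he : Tendsto (fun n => ‖((b : ℂ) ^ n)⁻¹ * (monicPoly μ n).eval z -
      conj C * (z - b)⁻¹ * G‖) atTop (𝓝 0) := by
    refine tendsto_zero_of_recursion (q := ‖z / b‖) (fun _ => norm_nonneg _) (norm_nonneg _) ?_
      (fun n => ?_) hd
    · rwa [norm_div, Complex.norm_real, Real.norm_of_nonneg hb0.le, div_lt_one hb0]
    · rw [rescaled_recursion hμ hb0 C hz G n]
      refine (norm_sub_le _ _).trans ?_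
      rw [norm_mul (z / b)]
  rw [tendsto_iff_norm_sub_tendsto_zero, ← tendsto_zero_iff_norm_tendsto_zero]
  have h1 := ((tendsto_zero_iff_norm_tendsto_zero.2 he).mul hNinv).add
    ((hNinv.sub_const (szegoFunction μ 0)⁻¹).const_mul (conj C * (z - b)⁻¹ * G))
  rw [zero_mul, sub_self, mul_zero, add_zero] at h1
  refine h1.congr fun n => ?_
  rw [mul_orthonormalPoly_sub μ _ _ hD, hG, mul_assoc _ (szegoFunction μ z)⁻¹]

theorem norm_orthonormalPoly_sub_le (hμ : Nontrivial μ) {b : ℝ} (hb0 : 0 < b) (hb1 : b < 1)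
    {C : ℂ} {Δ : ℝ} (hΔ0 : 0 < Δ) (hΔ1 : Δ < 1) (hC : BLSAsymptotics (verblunsky μ) b Δ C) :
    SzegoCondition μ ∧ ∀ ε : ℝ, 0 < ε → ∃ (C₁ Δ' : ℝ), 0 < Δ' ∧ Δ' < 1 ∧
      ∀ (n : ℕ) (z : ℂ), ‖z‖ < b - ε →
        ‖((b : ℂ) ^ n)⁻¹ * orthonormalPoly μ n z -
          conj C * (z - (b : ℂ))⁻¹ * (szegoFunction μ z)⁻¹‖ ≤ C₁ * Δ' ^ n := by
  -- As `(b Δ)ⁿ` never vanishes, the asymptotic bound holds for every `n` after enlarging the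
  -- constant.
  obtain ⟨K, hK0, hK⟩ := bound_of_isBigO_nat_atTop hC
  have hnb : ‖(b : ℂ)‖ = b := by rw [Complex.norm_real, Real.norm_of_nonneg hb0.le]
  have hK (n : ℕ) : ‖verblunsky μ n - C * (b : ℂ) ^ n‖ ≤ K * (b * Δ) ^ n := by
    have hp : 0 < (b * Δ) ^ n := by positivity
    have h := hK hp.ne'
    rwa [Real.norm_of_nonneg hp.le] at h
  have ha (n : ℕ) : ‖((b : ℂ) ^ n)⁻¹ * verblunsky μ n - C‖ ≤ K * Δ ^ n := by
    have hbn : (b : ℂ) ^ n ≠ 0 := pow_ne_zero _ (by exact_mod_cast hb0.ne')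
    have h : ((b : ℂ) ^ n)⁻¹ * verblunsky μ n - C =
        ((b : ℂ) ^ n)⁻¹ * (verblunsky μ n - C * (b : ℂ) ^ n) := by
      field_simp
    rw [h, norm_mul, norm_inv, norm_pow, hnb, inv_mul_le_iff₀ (pow_pos hb0 n)]
    refine (hK n).trans_eq ?_
    rw [mul_pow]; ring
  have hα (n : ℕ) : ‖verblunsky μ n‖ ≤ (K + ‖C‖) * b ^ n := by
    have h1 := norm_le_norm_sub_add (verblunsky μ n) (C * (b : ℂ) ^ n)
    rw [norm_mul, norm_pow, hnb] at h1
    have h2 : K * (b * Δ) ^ n ≤ K * b ^ n := by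
      gcongr
      exact mul_le_of_le_one_right hb0.le hΔ1.le
    linarith [hK n]
  obtain ⟨hS, M, hM⟩ := szego_asymptotics hμ hb0 hb1 hα
  refine ⟨hS, fun ε hε => ?_⟩
  have hD := szegoFunction_ne_zero μ 0
  have hM0 : 0 ≤ M := by simpa using (norm_nonneg _).trans (hM 0 0 (by simp))
  set D := szegoFunction μ 0 with hDdef
  have hg (z : ℂ) (hz : ‖z‖ < 1) : ‖(szegoFunction μ z)⁻¹‖ ≤ M + 1 := by
    have h := hM 0 z hz
    have h5 : (reversedPoly μ 0).eval z / (polyNorm μ (monicPoly μ 0) : ℂ) = 1 := by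
      simp [reversedPoly, monicPoly_zero, polyNorm]
    rw [h5, pow_zero, mul_one, norm_sub_rev] at h
    have := norm_le_norm_sub_add (szegoFunction μ z)⁻¹ 1
    rw [norm_one] at this
    linarith
  obtain ⟨R, hR0, hR⟩ : ∃ R : ℝ, 0 ≤ R ∧ ∀ (n : ℕ) (z : ℂ), ‖z‖ < 1 →
      ‖(reversedPoly μ n).eval z - (szegoFunction μ z)⁻¹ * D‖ ≤ R * b ^ n := by
    refine ⟨M + ‖D‖ * M * (M + 1), by positivity, fun n z hz => ?_⟩
    refine (norm_reversedPoly_sub_le hμ hM n hz).trans ?_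
    gcongr
    exact hg z hz
  set S := (M + 1) * ‖D‖ with hSdef
  have hS0 : 0 ≤ S := by positivity
  have hG (z : ℂ) (hz : ‖z‖ < 1) : ‖(szegoFunction μ z)⁻¹ * D‖ ≤ S := by
    rw [norm_mul]
    exact mul_le_mul_of_nonneg_right (hg z hz) (norm_nonneg _)
  -- The forcing term mixes two rates: `b` from `Φₙ*` and `Δ` from `b⁻ⁿ αₙ`.
  set r := max b Δ with hr
  have hr0 : 0 < r := lt_max_of_lt_left hb0
  have hr1 : r < 1 := max_lt hb1 hΔ1
  have hd (n : ℕ) (z : ℂ) (hz : ‖z‖ < 1) :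
      ‖(b : ℂ)⁻¹ * (conj (((b : ℂ) ^ n)⁻¹ * verblunsky μ n) * (reversedPoly μ n).eval z -
        conj C * ((szegoFunction μ z)⁻¹ * D))‖ ≤ b⁻¹ * (K * (R + S) + ‖C‖ * R) * r ^ n := by
    set G := (szegoFunction μ z)⁻¹ * D
    set a := ((b : ℂ) ^ n)⁻¹ * verblunsky μ n
    set Ψ := (reversedPoly μ n).eval z
    have h1 : conj a * Ψ - conj C * G = conj (a - C) * Ψ + conj C * (Ψ - G) := by
      rw [map_sub]; ring
    have h2 : ‖Ψ - G‖ ≤ R * r ^ n := (hR n z hz).trans (by gcongr; exact le_max_left _ _)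
    have h3 : ‖a - C‖ ≤ K * r ^ n := (ha n).trans (by gcongr; exact le_max_right _ _)
    have h4 : ‖Ψ‖ ≤ R + S := by
      have h5 := norm_le_norm_sub_add Ψ G
      have h6 : R * r ^ n ≤ R := mul_le_of_le_one_right hR0 (pow_le_one₀ hr0.le hr1.le)
      linarith [hG z hz]
    rw [norm_mul, norm_inv, hnb, mul_assoc]
    refine mul_le_mul_of_nonneg_left ?_ (inv_nonneg.2 hb0.le)
    rw [h1]
    refine (norm_add_le _ _).trans ?_
    rw [norm_mul, norm_mul, RCLike.norm_conj, RCLike.norm_conj]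
    calc
      _ ≤ K * r ^ n * (R + S) + ‖C‖ * (R * r ^ n) := by gcongr
      _ = _ := by ring
  set A := b⁻¹ * (K * (R + S) + ‖C‖ * R) with hA
  have hA0 : 0 ≤ A := by positivity
  set q := (b - ε) / b with hq
  have hq1 : q < 1 := by rw [hq, div_lt_one hb0]; linarith
  -- `q` bounds `|z/b|` but is not positive when `ε ≥ b`; the maximum with `r` repairs this.
  set p := max r q with hp
  have hp0 : 0 < p := lt_max_of_lt_left hr0
  have hp1 : p < 1 := max_lt hr1 hq1
  -- A rate strictly above both the contraction factor and the forcing rate avoids the factor `n`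
  -- that appears when these coincide.
  set s := (1 + p) / 2 with hs
  have hps : p < s := by rw [hs]; linarith
  have hs1 : s < 1 := by rw [hs]; linarith
  have hs0 : 0 < s := hp0.trans hps
  have hbs : b ≤ s := ((le_max_left b Δ).trans (le_max_left r q)).trans hps.le
  set V := ‖C‖ * ε⁻¹ * S with hV
  have hV0 : 0 ≤ V := by positivity
  -- `1 + V` dominates the initial error, since `Φ₀ = 1` and `V` bounds the limit (via `|z - b| ≥
  -- ε`); the other summand yields `A ≤ (s - p) B`.
  set B := (1 + V) + A / (s - p) with hB
  refine ⟨B * (M + ‖D⁻¹‖) + V * M, s, hs0, hs1, fun n z hz => ?_⟩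
  have hzb : ‖z‖ < b := by linarith
  have hz1 : ‖z‖ < 1 := hzb.trans hb1
  have hVz : ‖conj C * (z - b)⁻¹ * ((szegoFunction μ z)⁻¹ * D)‖ ≤ V := by
    rw [norm_mul, norm_mul, RCLike.norm_conj, norm_inv]
    have h1 : ε ≤ ‖z - b‖ := by
      have := norm_sub_norm_le (b : ℂ) z
      rw [hnb, norm_sub_rev] at this
      linarith
    have h2 := hG z hz1
    rw [hV]
    gcongr
  have he : ‖((b : ℂ) ^ n)⁻¹ * (monicPoly μ n).eval z -
      conj C * (z - b)⁻¹ * ((szegoFunction μ z)⁻¹ * D)‖ ≤ B * s ^ n := by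
    refine le_geometric_of_recursion (x := fun n => ‖((b : ℂ) ^ n)⁻¹ * (monicPoly μ n).eval z -
      conj C * (z - b)⁻¹ * ((szegoFunction μ z)⁻¹ * D)‖) (q := ‖z / b‖) (p := p) hA0 hr0.le
      ((le_max_left r q).trans hps.le) (fun m => ?_) (fun _ => norm_nonneg _) ?_ hp0.le ?_ ?_ n
    · rw [rescaled_recursion hμ hb0 C hzb _ m]
      refine (norm_sub_le _ _).trans ?_
      rw [norm_mul (z / b)]
      exact add_le_add le_rfl (hd m z hz1)
    · refine le_trans ?_ (le_max_right r q)
      rw [norm_div, hnb, hq]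
      gcongr
    · simp only [pow_zero, inv_one, one_mul, monicPoly_zero, eval_one]
      refine (norm_sub_le _ _).trans ?_
      rw [norm_one]
      have : 0 ≤ A / (s - p) := div_nonneg hA0 (by linarith)
      linarith
    · have h1 : (s - p) * (A / (s - p)) = A := mul_div_cancel₀ _ (by linarith)
      have h2 : 0 ≤ (s - p) * (1 + V) := mul_nonneg (by linarith) (by linarith)
      rw [hB, mul_add, h1]
      linarith
  have hN := norm_polyNorm_inv_sub_le hM n
  have hbn : M * b ^ n ≤ M * s ^ n := by gcongr
  have hN' : ‖(polyNorm μ (monicPoly μ n) : ℂ)⁻¹‖ ≤ M + ‖D⁻¹‖ := by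
    have h1 := norm_le_norm_sub_add (polyNorm μ (monicPoly μ n) : ℂ)⁻¹ D⁻¹
    have h2 : M * b ^ n ≤ M := mul_le_of_le_one_right hM0 (pow_le_one₀ hb0.le hb1.le)
    linarith
  rw [mul_orthonormalPoly_sub μ _ _ hD, mul_assoc _ (szegoFunction μ z)⁻¹ D]
  refine (norm_add_le _ _).trans ?_
  rw [norm_mul _ (polyNorm μ (monicPoly μ n) : ℂ)⁻¹, norm_mul _ (_ - _ : ℂ)]
  calc
    _ ≤ B * s ^ n * (M + ‖D⁻¹‖) + V * (M * s ^ n) :=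
      add_le_add (mul_le_mul he hN' (norm_nonneg _) ((norm_nonneg _).trans he))
        (mul_le_mul hVz (hN.trans hbn) (norm_nonneg _) hV0)
    _ = _ := by ring

end Rescaled

end OPUC

theorem theorem8p2 (μ : Measure Circle) [IsProbabilityMeasure μ] (hμ : OPUC.Nontrivial μ)
    (b : ℝ) (hb0 : 0 < b) (hb1 : b < 1) :
    (∀ C : ℂ, C ≠ 0 →
      Tendsto (fun n : ℕ => ((b : ℂ) ^ n)⁻¹ * OPUC.verblunsky μ n) atTop (𝓝 C) →
        OPUC.SzegoCondition μ ∧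
        ∀ z : ℂ, ‖z‖ < b →
          Tendsto (fun n : ℕ => ((b : ℂ) ^ n)⁻¹ * OPUC.orthonormalPoly μ n z) atTop
            (𝓝 (conj C * (z - (b : ℂ))⁻¹ * (OPUC.szegoFunction μ z)⁻¹))) ∧
    (∀ (C : ℂ) (Δ : ℝ), 0 < Δ → Δ < 1 →
      OPUC.BLSAsymptotics (OPUC.verblunsky μ) b Δ C →
        OPUC.SzegoCondition μ ∧
        ∀ ε : ℝ, 0 < ε → ∃ (C₁ Δ' : ℝ), 0 < Δ' ∧ Δ' < 1 ∧
          ∀ (n : ℕ) (z : ℂ), ‖z‖ < b - ε →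
            ‖((b : ℂ) ^ n)⁻¹ * OPUC.orthonormalPoly μ n z -
                conj C * (z - (b : ℂ))⁻¹ * (OPUC.szegoFunction μ z)⁻¹‖ ≤ C₁ * Δ' ^ n) := by
  exact ⟨fun _ _ hC => OPUC.tendsto_orthonormalPoly hμ hb0 hb1 hC,
    fun _ _ hΔ0 hΔ1 hC => OPUC.norm_orthonormalPoly_sub_le hμ hb0 hb1 hΔ0 hΔ1 hC⟩
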